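/- Let $\mathbb{F}_q$ be a finite field and let $g,n\ge 0$ be integers. Let $\mathcal{A}_g(\mathbb{F}_q)$ be the groupoid of principally polarized abelian varieties $(A,\lambda)$ of dimension $g$ over $\mathbb{F}_q$, whose morphisms are the isomorphisms of abelian varieties over $\mathbb{F}_q$ respecting the polarizations. Let $\mathcal{X}_g^{\times n}(\mathbb{F}_q)$ be the groupoid of $\mathbb{F}_q$-points of the $n$-th fibre power $\mathcal{X}_g\times_{\mathcal{A}_g}\cdots\times_{\mathcal{A}_g}\mathcal{X}_g$ of the universal family $\mathcal{X}_g\to\mathcal{A}_g$: its objects are the tuples $(A,\lambda;x_1,\dots,x_n)$ with $(A,\lambda)$ in $\mathcal{A}_g(\mathbb{F}_q)$ and $x_1,\dots,x_n\in A(\mathbb{F}_q)$, and its morphisms $(A,\lambda;\underline{x})\to(B,\mu;\underline{y})$ are the isomorphisms $f:(A,\lambda)\to(B,\mu)$ with $f(x_i)=y_i$ for all $i$. For a groupoid $\mathcal{G}$ write $[\mathcal{G}]$ for its set of isomorphism classes and $\#\mathcal{G}=\sum_{[x]\in[\mathcal{G}]}\frac{1}{\#\mathrm{Aut}(x)}$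 for its groupoid cardinality. Equip $[\mathcal{A}_g(\mathbb{F}_q)]$ with the discrete measure giving $[A,\lambda]$ the mass $\frac{1}{\#\mathcal{A}_g(\mathbb{F}_q)}\cdot\frac{1}{\#\mathrm{Aut}_{\mathbb{F}_q}(A,\lambda)}$, and let $\mathbb{E}(\#A_g(\mathbb{F}_q)^n)$ be the expected value of $[A,\lambda]\mapsto(\#A(\mathbb{F}_q))^n$ with respect to it, that is, $$\mathbb{E}(\#A_g(\mathbb{F}_q)^n)=\sum_{[A,\lambda]\in[\mathcal{A}_g(\mathbb{F}_q)]}\frac{\#A(\mathbb{F}_q)^n}{\#\mathcal{A}_g(\mathbb{F}_q)\,\#\mathrm{Aut}_{\mathbb{F}_q}(A,\lambda)}.$$ Then $$\mathbb{E}(\#A_g(\mathbb{F}_q)^n)=\frac{\#\mathcal{X}_g^{\times n}(\mathbb{F}_q)}{\#\mathcal{A}_g(\mathbb{F}_q)}.$$ (The sums have non-negative terms and are taken in $[0,\infty]$.) -/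

import Mathlib

open CategoryTheory AlgebraicGeometry Opposite
open scoped ENNReal

universe u

/-! ### Line bundles and the Picard group -/

section Picard

/-- Restriction of invertible functions to a smaller open set. -/
noncomputable def unitRes {X : Scheme.{u}} {U V : X.Opens} (h : V ≤ U) :
    Γ(X, U)ˣ →* Γ(X, V)ˣ :=
  Units.map ((X.presheaf.map (homOfLE h).op).hom : Γ(X, U) →* Γ(X, V))

/-- Pull-back of invertible functions along a morphism of schemes. -/
noncomputable def unitPull {X Y : Scheme.{u}} (f : X ⟶ Y) {U : Y.Opens} {V : X.Opens}
    (h : V ≤ f ⁻¹ᵁ U) : Γ(Y, U)ˣ →* Γ(X, V)ˣ :=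
  Units.map ((f.appLE U V h).hom : Γ(Y, U) →* Γ(X, V))

lemma unitRes_unitRes {X : Scheme.{u}} {U V W : X.Opens} (h : V ≤ U) (h' : W ≤ V)
    (a : Γ(X, U)ˣ) : unitRes h' (unitRes h a) = unitRes (h'.trans h) a := by
  ext
  simp only [unitRes, Units.coe_map, MonoidHom.coe_coe]
  rw [← CommRingCat.comp_apply, ← Functor.map_comp]
  rfl

lemma unitRes_unitPull {X Y : Scheme.{u}} (f : X ⟶ Y) {U : Y.Opens} {V W : X.Opens}
    (h : V ≤ f ⁻¹ᵁ U) (h' : W ≤ V) (a : Γ(Y, U)ˣ) :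
    unitRes h' (unitPull f h a) = unitPull f (h'.trans h) a := by
  ext
  simp only [unitRes, unitPull, Units.coe_map, MonoidHom.coe_coe]
  rw [← CommRingCat.comp_apply, Scheme.Hom.appLE_map]

lemma unitPull_unitRes {X Y : Scheme.{u}} (f : X ⟶ Y) {U U' : Y.Opens} {V : X.Opens}
    (h : V ≤ f ⁻¹ᵁ U') (h' : U' ≤ U) (h'' : V ≤ f ⁻¹ᵁ U) (a : Γ(Y, U)ˣ) :
    unitPull f h (unitRes h' a) = unitPull f h'' a := by
  ext
  simp only [unitRes, unitPull, Units.coe_map, MonoidHom.coe_coe]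
  rw [← CommRingCat.comp_apply, Scheme.Hom.map_appLE]

lemma unitPull_unitPull {X Y Z : Scheme.{u}} (f : X ⟶ Y) (g : Y ⟶ Z) {U : Z.Opens}
    {V : Y.Opens} {W : X.Opens} (h : W ≤ f ⁻¹ᵁ V) (h' : V ≤ g ⁻¹ᵁ U)
    (h'' : W ≤ (f ≫ g) ⁻¹ᵁ U) (a : Γ(Z, U)ˣ) :
    unitPull f h (unitPull g h' a) = unitPull (f ≫ g) h'' a := by
  ext
  simp only [unitPull, Units.coe_map, MonoidHom.coe_coe]
  rw [← CommRingCat.comp_apply, Scheme.Hom.appLE_comp_appLE]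

lemma unitPull_id {X : Scheme.{u}} {U V : X.Opens} (h : V ≤ (𝟙 X) ⁻¹ᵁ U) (h' : V ≤ U)
    (a : Γ(X, U)ˣ) : unitPull (𝟙 X) h a = unitRes h' a := by
  ext
  simp only [unitRes, unitPull, Units.coe_map, MonoidHom.coe_coe]
  simp only [Scheme.Hom.appLE, Scheme.Hom.id_app]
  change (CommRingCat.Hom.hom (𝟙 Γ(X, U) ≫ X.presheaf.map (homOfLE h').op)) _ = _
  rw [Category.id_comp]

/-- A line bundle on a scheme `X`, given by transition functions: an open cover `(U x)` of `X`
(indexed by the points of `X`, with `x ∈ U x`; every open cover has such a refinement) and a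
Čech 1-cocycle `g` of invertible functions on it. It stands for the invertible sheaf glued from the
sheaves `𝒪_{U x}`, whose sections are the families with `s x = g x y * s y`. -/
structure LineBundle (X : Scheme.{u}) where
  U : X → X.Opens
  mem : ∀ x, x ∈ U x
  g : ∀ x y, Γ(X, U x ⊓ U y)ˣ
  cocycle : ∀ x y z,
    unitRes (V := U x ⊓ U y ⊓ U z) inf_le_left (g x y) *
        unitRes (le_inf (inf_le_left.trans inf_le_right) inf_le_right) (g y z) =
      unitRes (le_inf (inf_le_left.trans inf_le_left) inf_le_right) (g x z)

namespace LineBundle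

variable {X Y Z : Scheme.{u}}

/-- The cocycle relation on an arbitrary smaller open set. -/
lemma cocycle' (L : LineBundle X) (x y z : X) {W : X.Opens} (h₁ : W ≤ L.U x ⊓ L.U y)
    (h₂ : W ≤ L.U y ⊓ L.U z) (h₃ : W ≤ L.U x ⊓ L.U z) :
    unitRes h₁ (L.g x y) * unitRes h₂ (L.g y z) = unitRes h₃ (L.g x z) := by
  have := congrArg (unitRes (V := W) (le_inf h₁ (h₂.trans inf_le_right))) (L.cocycle x y z)
  simpa only [map_mul, unitRes_unitRes] using this

/-- Two line bundles are isomorphic if their cocycles are cohomologous on a common refinement of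
the two covers. -/
def IsIsom (L M : LineBundle X) : Prop :=
  ∃ (V : X → X.Opens) (_ : ∀ x, x ∈ V x) (hL : ∀ x, V x ≤ L.U x) (hM : ∀ x, V x ≤ M.U x)
    (a : ∀ x, Γ(X, V x)ˣ), ∀ x y,
      unitRes (V := V x ⊓ V y) inf_le_left (a x) *
          unitRes (inf_le_inf (hL x) (hL y)) (L.g x y) =
        unitRes (inf_le_inf (hM x) (hM y)) (M.g x y) * unitRes inf_le_right (a y)

lemma IsIsom.refl (L : LineBundle X) : L.IsIsom L :=
  ⟨L.U, L.mem, fun _ => le_rfl, fun _ => le_rfl, fun _ => 1, by simp⟩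

lemma IsIsom.symm {L M : LineBundle X} : L.IsIsom M → M.IsIsom L := by
  rintro ⟨V, hV, hL, hM, a, h⟩
  refine ⟨V, hV, hM, hL, fun x => (a x)⁻¹, fun x y => ?_⟩
  rw [map_inv, map_inv, inv_mul_eq_iff_eq_mul, ← mul_assoc, h x y, mul_inv_cancel_right]

lemma IsIsom.trans {L M N : LineBundle X} : L.IsIsom M → M.IsIsom N → L.IsIsom N := by
  rintro ⟨V, hV, hL, hM, a, h⟩ ⟨V', hV', hM', hN, b, h'⟩
  refine ⟨fun x => V x ⊓ V' x, fun x => ⟨hV x, hV' x⟩, fun x => inf_le_left.trans (hL x),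
    fun x => inf_le_right.trans (hN x),
    fun x => unitRes inf_le_left (a x) * unitRes inf_le_right (b x), fun x y => ?_⟩
  have e := congrArg (unitRes (V := V x ⊓ V' x ⊓ (V y ⊓ V' y))
    (inf_le_inf inf_le_left inf_le_left)) (h x y)
  have e' := congrArg (unitRes (V := V x ⊓ V' x ⊓ (V y ⊓ V' y))
    (inf_le_inf inf_le_right inf_le_right)) (h' x y)
  simp only [map_mul, unitRes_unitRes] at e e' ⊢
  rw [mul_right_comm, e, mul_right_comm, mul_comm _ (unitRes _ (b x)), ← mul_assoc, e', mul_assoc,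
    mul_assoc, mul_comm (unitRes _ (b y))]

instance setoid (X : Scheme.{u}) : Setoid (LineBundle X) :=
  ⟨IsIsom, IsIsom.refl, IsIsom.symm, IsIsom.trans⟩

/-- The trivial line bundle. -/
def one (X : Scheme.{u}) : LineBundle X where
  U _ := ⊤
  mem _ := trivial
  g _ _ := 1
  cocycle := by simp

lemma one_g {x y : X} {W : X.Opens} (h : W ≤ (one X).U x ⊓ (one X).U y) :
    unitRes h ((one X).g x y) = 1 :=
  map_one _

/-- The tensor product of two line bundles. -/
noncomputable def tensor (L M : LineBundle X) : LineBundle X where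
  U x := L.U x ⊓ M.U x
  mem x := ⟨L.mem x, M.mem x⟩
  g x y := unitRes (inf_le_inf inf_le_left inf_le_left) (L.g x y) *
    unitRes (inf_le_inf inf_le_right inf_le_right) (M.g x y)
  cocycle x y z := by
    simp only [map_mul, unitRes_unitRes]
    rw [mul_mul_mul_comm, L.cocycle', M.cocycle']

lemma tensor_g (L M : LineBundle X) {x y : X} {W : X.Opens}
    (h : W ≤ (L.tensor M).U x ⊓ (L.tensor M).U y) (hL : W ≤ L.U x ⊓ L.U y)
    (hM : W ≤ M.U x ⊓ M.U y) :
    unitRes h ((L.tensor M).g x y) = unitRes hL (L.g x y) * unitRes hM (M.g x y) :=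
  (map_mul _ _ _).trans (congrArg₂ (· * ·) (unitRes_unitRes _ _ _) (unitRes_unitRes _ _ _))

/-- The dual of a line bundle. -/
noncomputable def dual (L : LineBundle X) : LineBundle X where
  U := L.U
  mem := L.mem
  g x y := (L.g x y)⁻¹
  cocycle x y z := by
    simp only [map_inv]
    rw [← mul_inv, L.cocycle]

lemma dual_g (L : LineBundle X) {x y : X} {W : X.Opens}
    (h : W ≤ L.dual.U x ⊓ L.dual.U y) (h' : W ≤ L.U x ⊓ L.U y) :
    unitRes h (L.dual.g x y) = (unitRes h' (L.g x y))⁻¹ :=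
  map_inv _ _

/-- The pull-back of a line bundle along a morphism. -/
noncomputable def pullback (f : X ⟶ Y) (L : LineBundle Y) : LineBundle X where
  U x := f ⁻¹ᵁ L.U (f x)
  mem x := L.mem (f x)
  g x y := unitPull f (U := L.U (f x) ⊓ L.U (f y)) (V := f ⁻¹ᵁ L.U (f x) ⊓ f ⁻¹ᵁ L.U (f y))
    (le_refl (f ⁻¹ᵁ (L.U (f x) ⊓ L.U (f y)))) (L.g (f x) (f y))
  cocycle x y z := by
    have l : f ⁻¹ᵁ L.U (f x) ⊓ f ⁻¹ᵁ L.U (f y) ⊓ f ⁻¹ᵁ L.U (f z) ≤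
        f ⁻¹ᵁ (L.U (f x) ⊓ L.U (f y) ⊓ L.U (f z)) := fun _ h => h
    have l₁ : f ⁻¹ᵁ L.U (f x) ⊓ f ⁻¹ᵁ L.U (f y) ⊓ f ⁻¹ᵁ L.U (f z) ≤
        f ⁻¹ᵁ (L.U (f x) ⊓ L.U (f y)) := fun _ h => h.1
    have l₂ : f ⁻¹ᵁ L.U (f x) ⊓ f ⁻¹ᵁ L.U (f y) ⊓ f ⁻¹ᵁ L.U (f z) ≤
        f ⁻¹ᵁ (L.U (f y) ⊓ L.U (f z)) := fun _ h => ⟨h.1.2, h.2⟩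
    have l₃ : f ⁻¹ᵁ L.U (f x) ⊓ f ⁻¹ᵁ L.U (f y) ⊓ f ⁻¹ᵁ L.U (f z) ≤
        f ⁻¹ᵁ (L.U (f x) ⊓ L.U (f z)) := fun _ h => ⟨h.1.1, h.2⟩
    have := congrArg (unitPull f l) (L.cocycle (f x) (f y) (f z))
    rw [map_mul, unitPull_unitRes f _ _ l₁, unitPull_unitRes f _ _ l₂,
      unitPull_unitRes f _ _ l₃] at this
    exact (congrArg₂ (· * ·) (unitRes_unitPull f _ _ _) (unitRes_unitPull f _ _ _)).trans
      (this.trans (unitRes_unitPull f _ _ _).symm)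

lemma pullback_g (f : X ⟶ Y) (L : LineBundle Y) {x y : X} {W : X.Opens}
    (h : W ≤ (L.pullback f).U x ⊓ (L.pullback f).U y)
    (h' : W ≤ f ⁻¹ᵁ (L.U (f x) ⊓ L.U (f y))) :
    unitRes h ((L.pullback f).g x y) = unitPull f h' (L.g (f x) (f y)) :=
  unitRes_unitPull _ _ _ _

lemma tensor_congr {L L' M M' : LineBundle X} :
    L.IsIsom L' → M.IsIsom M' → (L.tensor M).IsIsom (L'.tensor M') := by
  rintro ⟨V, hV, hL, hL', a, h⟩ ⟨V', hV', hM, hM', b, h'⟩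
  refine ⟨fun x => V x ⊓ V' x, fun x => ⟨hV x, hV' x⟩, fun x => inf_le_inf (hL x) (hM x),
    fun x => inf_le_inf (hL' x) (hM' x),
    fun x => unitRes inf_le_left (a x) * unitRes inf_le_right (b x), fun x y => ?_⟩
  have l₁ : V x ⊓ V' x ⊓ (V y ⊓ V' y) ≤ V x ⊓ V y := inf_le_inf inf_le_left inf_le_left
  have l₂ : V x ⊓ V' x ⊓ (V y ⊓ V' y) ≤ V' x ⊓ V' y := inf_le_inf inf_le_right inf_le_right
  have e := congrArg (unitRes l₁) (h x y)
  have e' := congrArg (unitRes l₂) (h' x y)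
  rw [tensor_g L M _ (l₁.trans (inf_le_inf (hL x) (hL y))) (l₂.trans (inf_le_inf (hM x) (hM y))),
    tensor_g L' M' _ (l₁.trans (inf_le_inf (hL' x) (hL' y)))
      (l₂.trans (inf_le_inf (hM' x) (hM' y)))]
  simp only [map_mul, unitRes_unitRes] at e e' ⊢
  rw [mul_mul_mul_comm, e, e', mul_mul_mul_comm]

lemma dual_congr {L L' : LineBundle X} : L.IsIsom L' → L.dual.IsIsom L'.dual := by
  rintro ⟨V, hV, hL, hL', a, h⟩
  refine ⟨V, hV, hL, hL', fun x => (a x)⁻¹, fun x y => ?_⟩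
  have := congrArg (·⁻¹) (h x y)
  rw [dual_g L _ (inf_le_inf (hL x) (hL y)), dual_g L' _ (inf_le_inf (hL' x) (hL' y))]
  simpa only [mul_inv, map_inv] using this

lemma pullback_congr (f : X ⟶ Y) {L L' : LineBundle Y} :
    L.IsIsom L' → (L.pullback f).IsIsom (L'.pullback f) := by
  rintro ⟨V, hV, hL, hL', a, h⟩
  refine ⟨fun x => f ⁻¹ᵁ V (f x), fun x => hV (f x), fun x => fun _ hy => hL (f x) hy,
    fun x => fun _ hy => hL' (f x) hy, fun x => unitPull f le_rfl (a (f x)), fun x y => ?_⟩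
  have l : f ⁻¹ᵁ V (f x) ⊓ f ⁻¹ᵁ V (f y) ≤ f ⁻¹ᵁ (V (f x) ⊓ V (f y)) := fun _ h => h
  have l₁ : f ⁻¹ᵁ V (f x) ⊓ f ⁻¹ᵁ V (f y) ≤ f ⁻¹ᵁ (L.U (f x) ⊓ L.U (f y)) :=
    fun _ hz => ⟨hL _ hz.1, hL _ hz.2⟩
  have l₂ : f ⁻¹ᵁ V (f x) ⊓ f ⁻¹ᵁ V (f y) ≤ f ⁻¹ᵁ (L'.U (f x) ⊓ L'.U (f y)) :=
    fun _ hz => ⟨hL' _ hz.1, hL' _ hz.2⟩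
  have e := congrArg (unitPull f l) (h (f x) (f y))
  rw [map_mul, map_mul, unitPull_unitRes f _ _ inf_le_left, unitPull_unitRes f _ _ l₁,
    unitPull_unitRes f _ _ l₂, unitPull_unitRes f _ _ inf_le_right] at e
  rw [pullback_g f L _ l₁, pullback_g f L' _ l₂, unitRes_unitPull, unitRes_unitPull]
  exact e

/-- Line bundles whose cocycles agree after restriction are isomorphic. -/
lemma isIsom_of_eq {L M : LineBundle X} (V : X → X.Opens) (hV : ∀ x, x ∈ V x)
    (hL : ∀ x, V x ≤ L.U x) (hM : ∀ x, V x ≤ M.U x)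
    (h : ∀ x y (W : X.Opens) (_ : W ≤ V x) (_ : W ≤ V y) (h₁ : W ≤ L.U x ⊓ L.U y)
      (h₂ : W ≤ M.U x ⊓ M.U y), unitRes h₁ (L.g x y) = unitRes h₂ (M.g x y)) : L.IsIsom M :=
  ⟨V, hV, hL, hM, fun _ => 1, fun x y => by
    rw [h x y _ inf_le_left inf_le_right _ (inf_le_inf (hM x) (hM y)), map_one, map_one, one_mul,
      mul_one]⟩

/-- A global section of the `n`-th tensor power of a line bundle. -/
structure PowSection (L : LineBundle X) (n : ℕ) where
  s : ∀ x, Γ(X, L.U x)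
  compat : ∀ x y,
    X.presheaf.map (homOfLE (inf_le_left : L.U x ⊓ L.U y ≤ L.U x)).op (s x) =
      (L.g x y : Γ(X, L.U x ⊓ L.U y)) ^ n *
        X.presheaf.map (homOfLE (inf_le_right : L.U x ⊓ L.U y ≤ L.U y)).op (s y)

/-- The open set `X_s` of points at which the section `s` generates. -/
def PowSection.nonvanishing {L : LineBundle X} {n : ℕ} (s : L.PowSection n) : X.Opens :=
  ⨆ x, X.basicOpen (s.s x)

/-- A line bundle `L` on `X` is ample if `X` is quasi-compact and every point of `X` lies in an
affine open set `X_s` for some section `s` of `L^n`, `n ≥ 1`. -/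
def IsAmple (L : LineBundle X) : Prop :=
  CompactSpace X ∧ ∀ p : X, ∃ n : ℕ, 1 ≤ n ∧ ∃ s : L.PowSection n,
    p ∈ s.nonvanishing ∧ IsAffineOpen s.nonvanishing

end LineBundle

/-- The Picard group of a scheme: isomorphism classes of line bundles. -/
def PicardGroup (X : Scheme.{u}) : Type u := Quotient (LineBundle.setoid X)

namespace PicardGroup

open LineBundle

variable {X Y Z : Scheme.{u}}

/-- The class of a line bundle. -/
def mk (L : LineBundle X) : PicardGroup X := Quotient.mk _ L

noncomputable instance : CommGroup (PicardGroup X) where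
  mul := Quotient.map₂ tensor fun _ _ h _ _ h' => tensor_congr h h'
  one := mk (LineBundle.one X)
  inv := Quotient.map dual fun _ _ h => dual_congr h
  mul_assoc := by
    rintro ⟨L⟩ ⟨M⟩ ⟨N⟩
    refine Quotient.sound (isIsom_of_eq (L := (L.tensor M).tensor N) (M := L.tensor (M.tensor N))
      (fun x => L.U x ⊓ M.U x ⊓ N.U x)
      (fun x => ⟨⟨L.mem x, M.mem x⟩, N.mem x⟩) (fun x => le_rfl)
      (fun x => (inf_assoc _ _ _).le) fun x y W hx hy h₁ h₂ => ?_)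
    have l₁ : W ≤ L.U x ⊓ L.U y := fun _ h => ⟨(hx h).1.1, (hy h).1.1⟩
    have l₂ : W ≤ M.U x ⊓ M.U y := fun _ h => ⟨(hx h).1.2, (hy h).1.2⟩
    have l₃ : W ≤ N.U x ⊓ N.U y := fun _ h => ⟨(hx h).2, (hy h).2⟩
    have l₁₂ : W ≤ (L.tensor M).U x ⊓ (L.tensor M).U y := fun _ h => ⟨(hx h).1, (hy h).1⟩
    have l₂₃ : W ≤ (M.tensor N).U x ⊓ (M.tensor N).U y :=
      fun _ h => ⟨⟨(hx h).1.2, (hx h).2⟩, ⟨(hy h).1.2, (hy h).2⟩⟩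
    rw [tensor_g (L.tensor M) N h₁ l₁₂ l₃, tensor_g L M l₁₂ l₁ l₂,
      tensor_g L (M.tensor N) h₂ l₁ l₂₃, tensor_g M N l₂₃ l₂ l₃, mul_assoc]
  one_mul := by
    rintro ⟨L⟩
    refine Quotient.sound (isIsom_of_eq (L := (LineBundle.one X).tensor L) (M := L) L.U L.mem
      (fun x => le_inf le_top le_rfl) (fun x => le_rfl) fun x y W hx hy h₁ h₂ => ?_)
    rw [tensor_g _ L _ (le_inf le_top le_top) h₂, one_g, one_mul]
  mul_one := by
    rintro ⟨L⟩
    refine Quotient.sound (isIsom_of_eq (L := L.tensor (LineBundle.one X)) (M := L) L.U L.mem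
      (fun x => le_inf le_rfl le_top) (fun x => le_rfl) fun x y W hx hy h₁ h₂ => ?_)
    rw [tensor_g L _ _ h₂ (le_inf le_top le_top), one_g, mul_one]
  inv_mul_cancel := by
    rintro ⟨L⟩
    refine Quotient.sound (isIsom_of_eq (L := L.dual.tensor L) (M := LineBundle.one X) L.U L.mem
      (fun x => le_inf le_rfl le_rfl) (fun x => le_top) fun x y W hx hy h₁ h₂ => ?_)
    have l : W ≤ L.dual.U x ⊓ L.dual.U y := le_inf hx hy
    rw [tensor_g L.dual L h₁ l (le_inf hx hy), dual_g L l (le_inf hx hy), one_g, inv_mul_cancel]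
  mul_comm := by
    rintro ⟨L⟩ ⟨M⟩
    refine Quotient.sound (isIsom_of_eq (L := L.tensor M) (M := M.tensor L)
      (fun x => L.U x ⊓ M.U x) (fun x => ⟨L.mem x, M.mem x⟩) (fun x => le_rfl)
      (fun x => (inf_comm _ _).le) fun x y W hx hy h₁ h₂ => ?_)
    have l₁ : W ≤ L.U x ⊓ L.U y := fun _ h => ⟨(hx h).1, (hy h).1⟩
    have l₂ : W ≤ M.U x ⊓ M.U y := fun _ h => ⟨(hx h).2, (hy h).2⟩
    rw [tensor_g L M _ l₁ l₂, tensor_g M L _ l₂ l₁, mul_comm]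

/-- Pull-back of line bundles, as a homomorphism of Picard groups. -/
noncomputable def map (f : X ⟶ Y) : PicardGroup Y →* PicardGroup X :=
  MonoidHom.mk' (Quotient.map (LineBundle.pullback f) fun _ _ h => pullback_congr f h) <| by
    rintro ⟨L⟩ ⟨M⟩
    refine Quotient.sound (isIsom_of_eq (L := (L.tensor M).pullback f)
      (M := (L.pullback f).tensor (M.pullback f)) (fun x => f ⁻¹ᵁ L.U (f x) ⊓ f ⁻¹ᵁ M.U (f x))
      (fun x => ⟨L.mem _, M.mem _⟩) (fun x => fun _ h => h) (fun x => le_rfl)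
      fun x y W hx hy h₁ h₂ => ?_)
    have l₁ : W ≤ f ⁻¹ᵁ (L.U (f x) ⊓ L.U (f y)) := fun _ h => ⟨(hx h).1, (hy h).1⟩
    have l₂ : W ≤ f ⁻¹ᵁ (M.U (f x) ⊓ M.U (f y)) := fun _ h => ⟨(hx h).2, (hy h).2⟩
    have l₃ : W ≤ f ⁻¹ᵁ ((L.tensor M).U (f x) ⊓ (L.tensor M).U (f y)) :=
      fun _ h => ⟨hx h, hy h⟩
    have l₁' : W ≤ (L.pullback f).U x ⊓ (L.pullback f).U y := l₁
    have l₂' : W ≤ (M.pullback f).U x ⊓ (M.pullback f).U y := l₂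
    rw [pullback_g f (L.tensor M) h₁ l₃, tensor_g (L.pullback f) (M.pullback f) h₂ l₁' l₂',
      pullback_g f L l₁' l₁, pullback_g f M l₂' l₂,
      ← unitPull_unitRes f l₃ (inf_le_inf inf_le_left inf_le_left) l₁,
      ← unitPull_unitRes f l₃ (inf_le_inf inf_le_right inf_le_right) l₂, ← map_mul]
    rfl

lemma map_id (a : PicardGroup X) : map (𝟙 X) a = a := by
  obtain ⟨L⟩ := a
  refine Quotient.sound (isIsom_of_eq (L := L.pullback (𝟙 X)) (M := L) L.U L.mem
    (fun x => le_rfl) (fun x => le_rfl) fun x y W hx hy h₁ h₂ => ?_)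
  rw [pullback_g (𝟙 X) L _ h₂]
  exact unitPull_id _ _ _

lemma map_comp (f : X ⟶ Y) (g : Y ⟶ Z) (a : PicardGroup Z) :
    map (f ≫ g) a = map f (map g a) := by
  obtain ⟨L⟩ := a
  refine Quotient.sound (isIsom_of_eq (L := L.pullback (f ≫ g)) (M := (L.pullback g).pullback f)
    (fun x => (f ≫ g) ⁻¹ᵁ L.U ((f ≫ g) x))
    (fun x => L.mem _) (fun x => le_rfl) (fun x => le_rfl) fun x y W hx hy h₁ h₂ => ?_)
  rw [pullback_g (f ≫ g) L _ (fun _ h => ⟨hx h, hy h⟩),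
    pullback_g f _ _ (fun _ h => ⟨hx h, hy h⟩)]
  exact (unitPull_unitPull f g _ _ _ _).symm

end PicardGroup

end Picard

/-! ### Abelian varieties, their duals and polarizations -/

section AbelianVarieties

open MonoidalCategory CartesianMonoidalCategory MonObj

variable {k : Type u} [Field k]

/-- The relative Picard functor of a `k`-scheme `A` with a rational point, at a `k`-scheme `T`:
line bundles on `A × T` modulo those pulled back from `T`. -/
abbrev RelPic (A T : Over (Spec (.of k))) : Type u :=
  PicardGroup (A ⊗ T).left ⧸ (PicardGroup.map (snd A T).left).range

namespace RelPic

variable {A B T T' T'' : Over (Spec (.of k))}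

/-- Pull-back of relative line bundle classes along a commutative square over `t : T' ⟶ T`. -/
noncomputable def pull (t : T' ⟶ T) (h : A ⊗ T' ⟶ B ⊗ T) (w : h ≫ snd B T = snd A T' ≫ t) :
    RelPic B T →* RelPic A T' :=
  QuotientGroup.map _ _ (PicardGroup.map h.left) <| by
    rintro _ ⟨a, rfl⟩
    refine ⟨PicardGroup.map t.left a, ?_⟩
    rw [← PicardGroup.map_comp, ← PicardGroup.map_comp, ← Over.comp_left, ← Over.comp_left, w]

/-- Base change along `t : T' ⟶ T`. -/
noncomputable def baseChange (A : Over (Spec (.of k))) (t : T' ⟶ T) : RelPic A T →* RelPic A T' :=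
  pull t (A ◁ t) (by simp)

/-- Pull-back along a morphism `f : A ⟶ B`. -/
noncomputable def pullAlong (f : A ⟶ B) (T : Over (Spec (.of k))) : RelPic B T →* RelPic A T :=
  pull (𝟙 T) (f ▷ T) (by simp)

/-- Pull-back along the translation `(a, t) ↦ (a * x t, t)` of `A × T` by a `T`-valued point
`x` of a group scheme `A`. -/
noncomputable def translate [GrpObj A] (x : T ⟶ A) : RelPic A T →* RelPic A T :=
  pull (𝟙 T) (lift (lift (fst A T) (snd A T ≫ x) ≫ μ) (snd A T)) (by simp)

lemma baseChange_id (a : RelPic A T) : baseChange A (𝟙 T) a = a := by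
  obtain ⟨a, rfl⟩ := QuotientGroup.mk_surjective a
  refine congrArg QuotientGroup.mk ?_
  rw [whiskerLeft_id, Over.id_left]
  exact PicardGroup.map_id a

lemma baseChange_comp (s : T'' ⟶ T') (t : T' ⟶ T) (a : RelPic A T) :
    baseChange A (s ≫ t) a = baseChange A s (baseChange A t a) := by
  obtain ⟨a, rfl⟩ := QuotientGroup.mk_surjective a
  refine congrArg QuotientGroup.mk ?_
  rw [whiskerLeft_comp, Over.comp_left]
  exact PicardGroup.map_comp _ _ a

lemma pullAlong_id (a : RelPic A T) : pullAlong (𝟙 A) T a = a := by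
  obtain ⟨a, rfl⟩ := QuotientGroup.mk_surjective a
  refine congrArg QuotientGroup.mk ?_
  rw [id_whiskerRight, Over.id_left]
  exact PicardGroup.map_id a

lemma pullAlong_comp {C : Over (Spec (.of k))} (f : A ⟶ B) (g : B ⟶ C) (a : RelPic C T) :
    pullAlong (f ≫ g) T a = pullAlong f T (pullAlong g T a) := by
  obtain ⟨a, rfl⟩ := QuotientGroup.mk_surjective a
  refine congrArg QuotientGroup.mk ?_
  rw [comp_whiskerRight, Over.comp_left]
  exact PicardGroup.map_comp _ _ a

end RelPic

/-- `Pic⁰` of a group scheme `A` at a `k`-scheme `T`: the classes whose restriction to the fibre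
of `A × T` over every geometric point of `T` is invariant under all translations. -/
def picZero (A T : Over (Spec (.of k))) [GrpObj A] : Subgroup (RelPic A T) where
  carrier := {a | ∀ (Ω : Type u) [Field Ω] [IsAlgClosed Ω] (p : Spec (.of Ω) ⟶ Spec (.of k))
    (t : Over.mk p ⟶ T) (x : Over.mk p ⟶ A),
      RelPic.translate x (RelPic.baseChange A t a) = RelPic.baseChange A t a}
  mul_mem' := by
    intro a b ha hb Ω _ _ p t x
    rw [map_mul, map_mul, ha Ω p t x, hb Ω p t x]
  one_mem' := by
    intro Ω _ _ p t x
    rw [map_one, map_one]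
  inv_mem' := by
    intro a ha Ω _ _ p t x
    rw [map_inv, map_inv, ha Ω p t x]

lemma baseChange_mem_picZero {A T T' : Over (Spec (.of k))} [GrpObj A] (t : T' ⟶ T)
    {a : RelPic A T} (ha : a ∈ picZero A T) : RelPic.baseChange A t a ∈ picZero A T' := by
  intro Ω _ _ p s x
  rw [← RelPic.baseChange_comp]
  exact ha Ω p (s ≫ t) x

/-- The functor of points `T ↦ Pic⁰_{A/k}(T)` of the dual of an abelian variety `A`. -/
noncomputable def dualFunctor (A : Over (Spec (.of k))) [GrpObj A] :
    (Over (Spec (.of k)))ᵒᵖ ⥤ GrpCat.{u} where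
  obj T := GrpCat.of (picZero A T.unop)
  map t := GrpCat.ofHom (((RelPic.baseChange A t.unop).comp (picZero A _).subtype).codRestrict _
    fun a => baseChange_mem_picZero t.unop a.2)
  map_id T := by
    ext (a : picZero A T.unop)
    exact RelPic.baseChange_id a.1
  map_comp s t := by
    ext (a : picZero A _)
    exact RelPic.baseChange_comp t.unop s.unop a.1

/-- The class of line bundles on `A × T` given by a `T`-valued point of the dual. -/
def dualClass {A T : Over (Spec (.of k))} [GrpObj A] (a : (dualFunctor A).obj (op T)) :
    RelPic A T :=
  Subtype.val (p := (· ∈ picZero A T)) a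

variable (k) in
/-- An abelian variety of dimension `g` over the field `k`: a group scheme over `k` that is proper
and geometrically integral. -/
structure AbelianVariety (g : ℕ) where
  X : Over (Spec (.of k))
  [grpObj : GrpObj X]
  [isProper : IsProper X.hom]
  [geometricallyIntegral : GeometricallyIntegral X.hom]
  dim_eq : topologicalKrullDim X.left = g

attribute [instance] AbelianVariety.grpObj AbelianVariety.isProper
  AbelianVariety.geometricallyIntegral

variable (k) in
/-- The spectrum of an algebraic closure of `k`, as a `k`-scheme. -/
noncomputable def specAlgClosure : Over (Spec (.of k)) :=
  Over.mk (Spec.map (CommRingCat.ofHom (algebraMap k (AlgebraicClosure k))))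

/-- A polarization of an abelian variety `A` over `k`: a homomorphism `A ⟶ A^∨` (given on
`T`-valued points) which over the algebraic closure is the homomorphism
`φ_L : x ↦ t_x^* L ⊗ L⁻¹` of an ample line bundle `L`. Here a scheme over the algebraic closure is
a `k`-scheme `T` with a `k`-morphism `t` to its spectrum. -/
structure Polarization {g : ℕ} (A : AbelianVariety k g) where
  hom : yonedaGrpObj A.X ⟶ dualFunctor A.X
  exists_ample : ∃ L : LineBundle (A.X ⊗ specAlgClosure k).left, L.IsAmple ∧
    ∀ (T : Over (Spec (.of k))) (t : T ⟶ specAlgClosure k) (x : T ⟶ A.X),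
      dualClass (hom.app (op T) x) =
        RelPic.translate x (RelPic.baseChange A.X t (QuotientGroup.mk (PicardGroup.mk L))) /
          RelPic.baseChange A.X t (QuotientGroup.mk (PicardGroup.mk L))

/-- A polarization is principal if it is an isomorphism onto the dual abelian variety. -/
def Polarization.IsPrincipal {g : ℕ} {A : AbelianVariety k g} (l : Polarization A) : Prop :=
  IsIso l.hom

/-- The value of a polarization at a `T`-valued point, as a class of line bundles on `A × T`. -/
noncomputable def Polarization.val {g : ℕ} {A : AbelianVariety k g} (l : Polarization A)
    {T : Over (Spec (.of k))} (x : T ⟶ A.X) : RelPic A.X T :=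
  dualClass (l.hom.app (op T) x)

variable (k) in
/-- Principally polarized abelian varieties of dimension `g` over `k`. -/
structure PPAV (g : ℕ) where
  A : AbelianVariety k g
  pol : Polarization A
  isPrincipal : pol.IsPrincipal

namespace PPAV

variable {g : ℕ}

/-- An isomorphism of principally polarized abelian varieties `(A, l) ⟶ (B, m)`: an isomorphism
`f : A ⟶ B` of group schemes over `k` such that `f^∨ ∘ m ∘ f = l`. -/
@[ext]
structure Hom (P Q : PPAV k g) where
  iso : P.A.X ≅ Q.A.X
  isMonHom : IsMonHom iso.hom
  compat : ∀ (T : Over (Spec (.of k))) (x : T ⟶ P.A.X),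
    RelPic.pullAlong iso.hom T (Q.pol.val (x ≫ iso.hom)) = P.pol.val x

/-- The groupoid `𝒜_g(k)` of principally polarized abelian varieties over `k`. -/
noncomputable instance : Groupoid (PPAV k g) where
  Hom := Hom
  id P := ⟨Iso.refl _, by dsimp; infer_instance, fun T x => by
    simp [RelPic.pullAlong_id]⟩
  comp {P Q R} f h := ⟨f.iso ≪≫ h.iso, by
    have := f.isMonHom
    have := h.isMonHom
    dsimp
    infer_instance, fun T x => by
    rw [Iso.trans_hom, RelPic.pullAlong_comp, ← Category.assoc, h.compat, f.compat]⟩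
  inv {P Q} f := ⟨f.iso.symm, by
    have := f.isMonHom
    dsimp
    infer_instance, fun T x => by
    have := f.compat T (x ≫ f.iso.inv)
    rw [Iso.symm_hom, ← this, ← RelPic.pullAlong_comp]
    simp [RelPic.pullAlong_id]⟩
  id_comp f := Hom.ext (Iso.refl_trans _)
  comp_id f := Hom.ext (Iso.trans_refl _)
  assoc f g h := Hom.ext (Iso.trans_assoc _ _ _)
  inv_comp f := Hom.ext (Iso.symm_self_id _)
  comp_inv f := Hom.ext (Iso.self_symm_id _)

/-- The set `A(k)` of rational points. -/
abbrev Points (P : PPAV k g) : Type u := Over.mk (𝟙 (Spec (.of k))) ⟶ P.A.X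

/-- The functor `(A, l) ↦ A(k)^n` on the groupoid `𝒜_g(k)`. -/
noncomputable def powPoints (k : Type u) [Field k] (g n : ℕ) : PPAV k g ⥤ Type u where
  obj P := Fin n → P.Points
  map {P Q} f := TypeCat.ofHom fun (x : Fin n → P.Points) i => x i ≫ (Hom.iso f).hom
  map_id P := by
    refine ConcreteCategory.hom_ext _ _ fun x => funext fun i => ?_
    exact Category.comp_id (x i)
  map_comp {P Q R} f h := by
    refine ConcreteCategory.hom_ext _ _ fun x => funext fun i => ?_
    exact (Category.assoc (x i) (Hom.iso f).hom (Hom.iso h).hom).symm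

end PPAV

/-- The groupoid `𝒳_g^{×n}(k)` of `k`-points of the `n`-th fibre power of the universal family over
`𝒜_g`: its objects are the tuples `(A, l; x₁, …, xₙ)` with `(A, l)` in `𝒜_g(k)` and `xᵢ ∈ A(k)`, its
morphisms the isomorphisms `f` of principally polarized abelian varieties with `f (xᵢ) = yᵢ`. -/
abbrev UniversalFamilyPower (k : Type u) [Field k] (g n : ℕ) : Type (u + 1) :=
  (PPAV.powPoints k g n).Elements

end AbelianVarieties

/-! ### Groupoid cardinality and expected values -/

section GroupoidCardinality

universe v w

/-- The set of isomorphism classes of objects of a groupoid, as a discrete measurable space. -/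
def IsoClasses (C : Type w) [Groupoid.{v} C] : Type w := Quotient (isIsomorphicSetoid C)

instance (C : Type w) [Groupoid.{v} C] : MeasurableSpace (IsoClasses C) := ⊤

/-- The number of automorphisms of an isomorphism class. -/
noncomputable def autCard {C : Type w} [Groupoid.{v} C] : IsoClasses C → ℝ≥0∞ :=
  Quotient.lift (fun X => (ENat.card (Aut X) : ℝ≥0∞)) fun _ _ ⟨e⟩ =>
    congrArg _ (ENat.card_congr e.conjAut.toEquiv)

/-- The groupoid cardinality: the sum of `1 / #Aut(X)` over the isomorphism classes of objects. It
is an unconditional sum in `[0, ∞]`, so that no finiteness has to be presupposed. -/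
noncomputable def groupoidCard (C : Type w) [Groupoid.{v} C] : ℝ≥0∞ :=
  ∑' c : IsoClasses C, 1 / autCard c

variable (k : Type u) [Field k] (g : ℕ)

/-- The measure on the set of isomorphism classes of `𝒜_g(k)` that gives the class of `(A, l)` the
mass `1 / (#𝒜_g(k) * #Aut(A, l))`. -/
noncomputable def ppavMeasure : MeasureTheory.Measure (IsoClasses (PPAV k g)) :=
  (groupoidCard (PPAV k g))⁻¹ •
    MeasureTheory.Measure.sum fun c => (autCard c)⁻¹ • MeasureTheory.Measure.dirac c

variable {k g} in
/-- The random variable `[A, l] ↦ #A(k)`. -/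
noncomputable def pointCount : IsoClasses (PPAV k g) → ℝ≥0∞ :=
  Quotient.lift (fun P => (ENat.card P.Points : ℝ≥0∞)) fun _ _ ⟨e⟩ =>
    congrArg _ (ENat.card_congr (e.hom.iso.homToEquiv))

/-- The `n`-th moment `E((#A_g(k))^n)` of the number of rational points. -/
noncomputable def expectedPointCountPow (n : ℕ) : ℝ≥0∞ :=
  ∫⁻ c, pointCount c ^ n ∂(ppavMeasure k g)

end GroupoidCardinality

/-! ### Finiteness of the set of rational points -/

section FinitePoints

/-! Both sides equal `1 / #𝒜_g(k)` times the sum of `#A(k)^n / #Aut(A, l)` over the classes `[A,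
l]`. On the left this is integration against a weighted sum of Dirac masses.

On the right, the groupoid is the category of elements of `F : (A, l) ↦ A(k)^n`. Its classes over a
fixed `[X]` are the orbits of `Aut X` on `F.obj X`, and the automorphisms of an element form its
stabilizer. By orbit-stabilizer an orbit `O` contributes `1 / #Stab = #O / #Aut X`, and summing over
orbits gives `#F.obj X / #Aut X`. This is `groupoidCard_elements`, valid for any functor with finite
values on a groupoid.

The geometric input is that `A(k)` is finite (`PPAV.finite_points`). Neither `Aut X` nor the set of
classes has to be finite, but orbits do: for an infinite orbit with finite stabilizer, `1 / #Stab`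
is positive while `#O * (#Aut X)⁻¹ = ∞ * 0 = 0`. -/

/-- A ring of finite type over a finite ring has only finitely many homomorphisms to a finite
ring. -/
lemma finite_ringHom_of_finiteType {R A S : Type*} [CommRing R] [CommRing A] [CommRing S]
    [Finite R] [Finite S] {φ : R →+* A} (hφ : φ.FiniteType) : Finite (A →+* S) := by
  algebraize [φ]
  obtain ⟨s, hs⟩ := Algebra.FiniteType.out (R := R) (A := A)
  -- The homomorphisms need not be `R`-linear, so values on the generators do not suffice: the
  -- composite with `φ` is recorded too.
  refine Finite.of_injective (β := (R → S) × (s → S)) (fun f => (f ∘ φ, fun a => f a))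
    fun f f' h => ?_
  obtain ⟨h₁, h₂⟩ := Prod.ext_iff.1 h
  ext a
  have ha : a ∈ Algebra.adjoin R (s : Set A) := hs ▸ Algebra.mem_top
  induction ha using Algebra.adjoin_induction with
  | mem x hx => exact congrFun h₂ ⟨x, hx⟩
  | algebraMap r => exact congrFun h₁ r
  | add x y _ _ hx hy => rw [map_add, map_add, hx, hy]
  | mul x y _ _ hx hy => rw [map_mul, map_mul, hx, hy]

variable {k : Type u} [Field k] [Finite k]

instance finite_globalSections_spec : Finite Γ(Spec (.of k), ⊤) :=
  Finite.of_equiv k (Scheme.ΓSpecIso (.of k)).commRingCatIsoToRingEquiv.symm.toEquiv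

/-- An affine scheme of finite type over a finite field has finitely many points valued in that
field. -/
lemma finite_hom_of_isAffine {Y : Scheme.{u}} [IsAffine Y] (f : Y ⟶ Spec (.of k))
    [LocallyOfFiniteType f] : Finite (Spec (.of k) ⟶ Y) := by
  have : Finite (Γ(Y, ⊤) →+* Γ(Spec (.of k), ⊤)) :=
    finite_ringHom_of_finiteType
      (f.finiteType_appLE (isAffineOpen_top _) (isAffineOpen_top _) le_top)
  exact Finite.of_injective (fun x : Spec (.of k) ⟶ Y => x.appTop.hom)
    fun x y h => ext_of_isAffine (CommRingCat.hom_ext h)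

/-- A scheme of finite type over a finite field has finitely many points valued in that field. -/
lemma finite_hom_of_finiteType {X : Scheme.{u}} [CompactSpace X] (f : X ⟶ Spec (.of k))
    [LocallyOfFiniteType f] : Finite (Spec (.of k) ⟶ X) := by
  let 𝒰 := X.affineCover.finiteSubcover
  have : ∀ i, IsAffine (𝒰.X i) := fun i => by
    dsimp [𝒰]
    infer_instance
  have : ∀ i, Finite (Spec (.of k) ⟶ 𝒰.X i) := fun i => finite_hom_of_isAffine (𝒰.f i ≫ f)
  have : Finite 𝒰.I₀ := by
    dsimp [𝒰]
    infer_instance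
  refine Finite.of_surjective (α := Σ i, Spec (.of k) ⟶ 𝒰.X i) (fun p => p.2 ≫ 𝒰.f p.1)
    fun x => ?_
  let p : Spec (.of k) := default
  obtain ⟨y, hy⟩ := 𝒰.covers (x p)
  -- `Spec k` has a single point, so a morphism from it lands in any chart containing the image of
  -- that point and factors through it.
  have hx : Set.range x ⊆ Set.range (𝒰.f (𝒰.idx (x p))) := by
    rintro _ ⟨z, rfl⟩
    rw [Subsingleton.elim z p]
    exact ⟨y, hy⟩
  exact ⟨⟨_, IsOpenImmersion.lift (𝒰.f _) x hx⟩, IsOpenImmersion.lift_fac _ _ _⟩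

/-- Properness gives both conditions needed: quasi-compactness and local finite type. -/
instance PPAV.finite_points {g : ℕ} (P : PPAV k g) : Finite P.Points := by
  have : CompactSpace P.A.X.left := QuasiCompact.compactSpace_of_compactSpace P.A.X.hom
  have : Finite ((Over.mk (𝟙 (Spec (.of k)))).left ⟶ P.A.X.left) :=
    finite_hom_of_finiteType P.A.X.hom
  exact Finite.of_injective (fun x : P.Points => x.left) fun _ _ h => Over.OverMorphism.ext h

end FinitePoints

/-! ### Groupoid cardinality of a category of elements -/

section Elements

universe v w w'

variable {C : Type w} [Groupoid.{v} C] (F : C ⥤ Type w')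

/-- The automorphism group of an object acts on the value of a functor to types. -/
@[reducible]
def functorAutAction (X : C) : MulAction (Aut X) (F.obj X) where
  smul e x := F.map e.hom x
  one_smul x := F.map_id_apply X x
  -- The product in `Aut X` is composition in function order, so this is a left action.
  mul_smul e e' x := F.map_comp_apply e'.hom e.hom x

/-- The map on isomorphism classes that forgets the element and keeps the object. -/
def isoClassesForget : IsoClasses F.Elements → IsoClasses C :=
  Quotient.map Sigma.fst fun _ _ ⟨e⟩ => ⟨(CategoryOfElements.π F).mapIso e⟩

/-- The class of an element `x` of `F.obj X` in the fibre over the class of `X`. -/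
def elementClass (X : C) (x : F.obj X) :
    {c : IsoClasses F.Elements // isoClassesForget F c = Quotient.mk _ X} :=
  ⟨Quotient.mk _ (F.elementsMk X x), rfl⟩

/-- Transporting the element along an isomorphism of underlying objects moves it into `F.obj X`
without changing its class. -/
lemma elementClass_surjective (X : C) : Function.Surjective (elementClass F X) := by
  rintro ⟨⟨p⟩, hp⟩
  obtain ⟨e⟩ : Nonempty (p.1 ≅ X) := Quotient.exact hp
  exact ⟨F.map e.hom p.2, Subtype.ext <| Quotient.sound
    ⟨(CategoryOfElements.isoMk p (F.elementsMk X (F.map e.hom p.2)) e rfl).symm⟩⟩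

/-- This identifies the fibres of `elementClass F X` with the orbits of `Aut X`. -/
lemma elementClass_eq_iff {X : C} {x y : F.obj X} :
    elementClass F X x = elementClass F X y ↔ ∃ e : Aut X, F.map e.hom y = x := by
  refine ⟨fun h => ?_, fun ⟨e, he⟩ => Subtype.ext <| Quotient.sound
    ⟨(CategoryOfElements.isoMk (F.elementsMk X y) (F.elementsMk X x) e he).symm⟩⟩
  obtain ⟨e⟩ : Nonempty (F.elementsMk X x ≅ F.elementsMk X y) :=
    Quotient.exact (congrArg Subtype.val h)
  -- The automorphism has to carry `y` to `x`, hence the inverse of `e`.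
  exact ⟨(CategoryOfElements.π F).mapIso e.symm, e.inv.2⟩

/-- Automorphisms of an element are the automorphisms of the underlying object that fix it. -/
def autElementEquiv (X : C) (x : F.obj X) :
    Aut (F.elementsMk X x) ≃ {e : Aut X // F.map e.hom x = x} where
  toFun e := ⟨(CategoryOfElements.π F).mapIso e, e.hom.2⟩
  invFun e := CategoryOfElements.isoMk _ _ e.1 e.2
  left_inv _ := rfl
  right_inv _ := rfl

/-- Orbit-stabilizer for a category of elements. -/
lemma card_fiber_mul_card_aut (X : C) (x : F.obj X) :
    ENat.card (elementClass F X ⁻¹' {elementClass F X x}) *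
      ENat.card (Aut (F.elementsMk X x)) = ENat.card (Aut X) := by
  let := functorAutAction F X
  have e : elementClass F X ⁻¹' {elementClass F X x} = MulAction.orbit (Aut X) x :=
    Set.ext fun y => elementClass_eq_iff F
  rw [e, ENat.card_congr (autElementEquiv F X x), ← ENat.card_prod]
  exact ENat.card_congr (MulAction.orbitProdStabilizerEquivGroup (Aut X) x)

/-- Orbit-stabilizer in divided form: each class over `[X]` is weighted by the size of its orbit. -/
lemma one_div_autCard_eq (X : C) [Finite (F.obj X)]
    (c : {c : IsoClasses F.Elements // isoClassesForget F c = Quotient.mk _ X}) :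
    1 / autCard c.1 = ENat.card (elementClass F X ⁻¹' {c}) * (ENat.card (Aut X) : ℝ≥0∞)⁻¹ := by
  obtain ⟨x, rfl⟩ := elementClass_surjective F X c
  -- The orbit contains `x` and is finite; both facts are needed to cancel its size in `[0, ∞]`.
  have h₀ : ((ENat.card (elementClass F X ⁻¹' {elementClass F X x}) : ℕ∞) : ℝ≥0∞) ≠ 0 := by
    have h : (elementClass F X ⁻¹' {elementClass F X x}).Nonempty := ⟨x, rfl⟩
    simpa using h.ne_empty
  have h₁ : ((ENat.card (elementClass F X ⁻¹' {elementClass F X x}) : ℕ∞) : ℝ≥0∞) ≠ ∞ := by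
    simpa using Set.toFinite _
  change 1 / ((ENat.card (Aut (F.elementsMk X x)) : ℕ∞) : ℝ≥0∞) = _
  rw [← card_fiber_mul_card_aut F X x, ENat.toENNReal_mul,
    ENNReal.mul_inv (.inl h₀) (.inl h₁), ← mul_assoc, ENNReal.mul_inv_cancel h₀ h₁, one_mul,
    one_div]

/-- The fibres of `f` partition `α`; each cardinality is a sum of ones. -/
lemma tsum_card_fiber {α β : Type*} (f : α → β) :
    ∑' b, (ENat.card (f ⁻¹' {b}) : ℝ≥0∞) = ENat.card α := by
  simp_rw [← ENNReal.tsum_one]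
  rw [← (Equiv.sigmaFiberEquiv f).tsum_eq, ENNReal.tsum_sigma']
  rfl

/-- The groupoid cardinality of a category of elements with finite fibres is the weighted sum of
the cardinalities of the fibres. -/
lemma groupoidCard_elements [∀ X, Finite (F.obj X)] (N : IsoClasses C → ℝ≥0∞)
    (hN : ∀ X, N (Quotient.mk _ X) = ENat.card (F.obj X)) :
    groupoidCard F.Elements = ∑' c, (autCard c)⁻¹ * N c := by
  rw [groupoidCard, ← (Equiv.sigmaFiberEquiv (isoClassesForget F)).tsum_eq, ENNReal.tsum_sigma']
  refine tsum_congr fun c => ?_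
  obtain ⟨X, rfl⟩ := Quotient.exists_rep c
  -- Splitting `F.obj X` into orbits turns both sides into sums over the classes above `[X]`, which
  -- agree term by term.
  rw [hN, ← tsum_card_fiber (elementClass F X), mul_comm, ← ENNReal.tsum_mul_right]
  exact tsum_congr fun c => one_div_autCard_eq F X c

end Elements

theorem mainTheorem8 (k : Type u) [Field k] [Finite k] (g n : ℕ) :
    expectedPointCountPow k g n =
      groupoidCard (UniversalFamilyPower k g n) / groupoidCard (PPAV k g) := by
  have (P : PPAV k g) : Finite ((PPAV.powPoints k g n).obj P) :=
    inferInstanceAs (Finite (Fin n → P.Points))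
  have hN (P : PPAV k g) : pointCount (Quotient.mk _ P) ^ n =
      ((ENat.card ((PPAV.powPoints k g n).obj P) : ℕ∞) : ℝ≥0∞) := by
    change ((ENat.card P.Points : ℕ∞) : ℝ≥0∞) ^ n =
      ((ENat.card (Fin n → P.Points) : ℕ∞) : ℝ≥0∞)
    -- Finiteness of `A(k)` reduces this to a count in `ℕ`.
    simp [ENat.card_eq_coe_natCard, Nat.card_fun]
  rw [groupoidCard_elements _ (fun c => pointCount c ^ n) hN, expectedPointCountPow, ppavMeasure,
    MeasureTheory.lintegral_smul_measure, MeasureTheory.lintegral_sum_measure, smul_eq_mul,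
    mul_comm, div_eq_mul_inv]
  -- The common factor `(#𝒜_g(k))⁻¹` is matched rather than cancelled, so it may be `0` or `∞`.
  congr 1
  refine tsum_congr fun c => ?_
  rw [MeasureTheory.lintegral_smul_measure, MeasureTheory.lintegral_dirac' _ measurable_from_top,
    smul_eq_mul]
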